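/- Let $\sigma>0$ and let $\mathcal C$ be one of the four Bogoliubov–de Gennes symmetry classes B, D, C, CI, with parameters $(\alpha,\beta,\psi_{\mathcal C})=(2,2,2)$ for B, $(0,2,2)$ for D, $(2,2,4)$ for C, and $(1,1,4)$ for CI. For $n\ge 1$ put $w_n(x)=x^{\alpha/n}\exp\!\big(-\tfrac{x^2}{\psi_{\mathcal C}\sigma^2}\big)$ for $x\ge 0$ and let $$Z_n=\int_{[0,\infty)^n}\ \prod_{1\le i<j\le n}|\lambda_i^2-\lambda_j^2|^{\beta}\ \prod_{j=1}^n w_n(\lambda_j)^n\ d\lambda_1\cdots d\lambda_n$$ be the partition function of the joint eigenvalue density. Then $0<Z_n<\infty$ for every $n\ge 1$, and the limit of $\frac1n\log\frac{Z_{n-1}}{Z_n}$ exists, with $$\xi:=\lim_{n\to\infty}\frac1n\log\frac{Z_{n-1}}{Z_n}=-\beta\log\Big(\frac{\beta\,\psi_{\mathcal C}\,\sigma^2}{2}\Big)+\frac32\,\beta .$$ -/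

import Mathlib

open Filter Topology MeasureTheory

noncomputable section

namespace BdG

/-- The four Bogoliubov-de Gennes symmetry classes B, D, C and CI. -/
inductive SymClass
  | B
  | D
  | C
  | CI

/-- The exponent `α` of the factor `x ^ α` in the joint eigenvalue density. -/
def SymClass.α : SymClass → ℝ
  | .B => 2
  | .D => 0
  | .C => 2
  | .CI => 1

/-- The exponent `β` of the eigenvalue repulsion. -/
def SymClass.β : SymClass → ℝ
  | .B => 2
  | .D => 2
  | .C => 2
  | .CI => 1

/-- The scale `ψ` of the Gaussian factor. -/
def SymClass.ψ : SymClass → ℝ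
  | .B => 2
  | .D => 2
  | .C => 4
  | .CI => 4

/-- The weight `w_n(x) = x ^ (α / n) * exp (- x ^ 2 / (ψ σ ^ 2))`, used for `x ≥ 0`, `n ≥ 1`. -/
def weight (𝒞 : SymClass) (σ : ℝ) (n : ℕ) (x : ℝ) : ℝ :=
  x ^ (𝒞.α / (n : ℝ)) * Real.exp (-(1 / (𝒞.ψ * σ ^ 2)) * x ^ 2)

/-- The unnormalised joint density of the `n` eigenvalues,
`∏_{i < j} |x_i ^ 2 - x_j ^ 2| ^ β * ∏_j w_n(x_j) ^ n`. -/
def density (𝒞 : SymClass) (σ : ℝ) (n : ℕ) (x : Fin n → ℝ) : ℝ :=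
  (∏ i : Fin n, ∏ j ∈ Finset.Ioi i, |x i ^ 2 - x j ^ 2| ^ 𝒞.β) *
    ∏ j : Fin n, weight 𝒞 σ n (x j) ^ n

/-- The domain `[0, ∞) ^ n` of the eigenvalues. -/
def domain (n : ℕ) : Set (Fin n → ℝ) := {x | ∀ i, 0 ≤ x i}

/-- The partition function `Z_n`. -/
def Z (𝒞 : SymClass) (σ : ℝ) (n : ℕ) : ℝ :=
  ∫ x in domain n, density 𝒞 σ n x

end BdG

end

namespace BdG

/-! With `c = n / (ψ σ²)`, `Z_n` is the uniform moment `M_α(n)`: the integral of `∏ x_i ^ α` against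
a Gaussian times the `b`-th power of the Vandermonde product of the squares. Two exact recurrences,
both instances of one integration by parts in a single variable, replace Selberg's integral.
Differentiating the repulsion gives terms with denominator `x_0² - x_j²`. Exchanging `x_0` and `x_j`
changes the sign of this denominator, so for suitable exponents the term vanishes or is half an
ordinary moment. Raising the exponents by 2 one coordinate at a time then gives `M_{α+2}(n) = M_α(n)
∏_{j<n} (α + 1 + b j) / (2c)` (`uniformMoment_add_two`). When nothing vanishes at `x_0 = 0`, the
boundary term survives and gives `2c M_1(n+1) = M_{1+2b}(n)` (`uniformMoment_one_succ`). As `1 + 2b`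
is `b` raisings above 1, together they give a closed recurrence in `n` for `M_1`. This settles CI.
For the other classes `b = 2` and `α` is 0 or 2, off the odd chain; Cauchy-Schwarz
(`uniformMoment_sq_le`) and the known ratios `M_2/M_0`, `M_3/M_1` fix `log M_α - log M_1` up to `log
(2n)`, which is negligible after division by `n`. Stirling's formula gives the limit. -/

/-- Lebesgue measure on the half line. -/
noncomputable def halfLine : Measure ℝ := volume.restrict (Set.Ioi 0)

instance : SigmaFinite halfLine := by unfold halfLine; infer_instance

/-- Lebesgue measure on the positive orthant. -/
noncomputable def orthant (n : ℕ) : Measure (Fin n → ℝ) := Measure.pi fun _ => halfLine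

instance (n : ℕ) : SigmaFinite (orthant n) := by unfold orthant; infer_instance

/-- The absolute value of the Vandermonde determinant of the squares. -/
noncomputable def sqVandermonde {n : ℕ} (x : Fin n → ℝ) : ℝ :=
  ∏ i, ∏ j ∈ Finset.Ioi i, |x i ^ 2 - x j ^ 2|

/-- The product Gaussian weight. -/
noncomputable def gauss (c : ℝ) {n : ℕ} (x : Fin n → ℝ) : ℝ := ∏ i, Real.exp (-c * x i ^ 2)

/-- The Gaussian weight together with the eigenvalue repulsion. -/
noncomputable def kernel (b : ℕ) (c : ℝ) {n : ℕ} (x : Fin n → ℝ) : ℝ :=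
  sqVandermonde x ^ b * gauss c x

/-- The moment of the kernel with exponents `p`. -/
noncomputable def moment (b : ℕ) (c : ℝ) {n : ℕ} (p : Fin n → ℕ) : ℝ :=
  ∫ x, (∏ i, x i ^ p i) * kernel b c x ∂orthant n

/-- The polynomial majorant. -/
noncomputable def majorant {n : ℕ} (x : Fin n → ℝ) : ℝ := ∏ i, (1 + x i ^ 2)

/-- Domination by a power of the majorant. -/
def PolyBounded {n : ℕ} (f : (Fin n → ℝ) → ℝ) : Prop := ∃ N : ℕ, ∀ x, |f x| ≤ majorant x ^ N

/-! ### Polynomial bounds and integrability against the Gaussian -/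

theorem one_le_prod_one_add_sq {n : ℕ} (x : Fin n → ℝ) (s : Finset (Fin n)) :
    1 ≤ ∏ i ∈ s, (1 + x i ^ 2) :=
  Finset.prod_induction _ (fun r => 1 ≤ r) (fun _ _ => one_le_mul_of_one_le_of_one_le)
    le_rfl fun j _ => by nlinarith [sq_nonneg (x j)]

theorem one_le_majorant {n : ℕ} (x : Fin n → ℝ) : 1 ≤ majorant x :=
  one_le_prod_one_add_sq x _

theorem one_add_sq_le_majorant {n : ℕ} (x : Fin n → ℝ) (i : Fin n) : 1 + x i ^ 2 ≤ majorant x := by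
  unfold majorant
  rw [← Finset.mul_prod_erase _ _ (Finset.mem_univ i)]
  exact le_mul_of_one_le_right (by positivity) (one_le_prod_one_add_sq x _)

namespace PolyBounded

variable {n : ℕ}

theorem mul {f g : (Fin n → ℝ) → ℝ} (hf : PolyBounded f) (hg : PolyBounded g) :
    PolyBounded fun x => f x * g x := by
  obtain ⟨N, hN⟩ := hf
  obtain ⟨M, hM⟩ := hg
  refine ⟨N + M, fun x => ?_⟩
  rw [abs_mul, pow_add]
  exact mul_le_mul (hN x) (hM x) (abs_nonneg _) (by have := one_le_majorant x; positivity)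

theorem of_abs_le_one {f : (Fin n → ℝ) → ℝ} (h : ∀ x, |f x| ≤ 1) : PolyBounded f :=
  ⟨0, fun x => by simpa using h x⟩

theorem pow {f : (Fin n → ℝ) → ℝ} (hf : PolyBounded f) (k : ℕ) :
    PolyBounded fun x => f x ^ k := by
  induction k with
  | zero => exact of_abs_le_one fun x => by simp
  | succ k ih => simpa only [pow_succ] using ih.mul hf

theorem prod {ι : Type*} (s : Finset ι) {f : ι → (Fin n → ℝ) → ℝ}
    (hf : ∀ i ∈ s, PolyBounded (f i)) : PolyBounded fun x => ∏ i ∈ s, f i x := by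
  classical
  induction s using Finset.induction_on with
  | empty => exact of_abs_le_one fun x => by simp
  | insert a s ha ih =>
    simp only [Finset.prod_insert ha]
    exact (hf a (Finset.mem_insert_self a s)).mul
      (ih fun i hi => hf i (Finset.mem_insert_of_mem hi))

theorem eval (i : Fin n) : PolyBounded fun x => x i :=
  ⟨1, fun x => by
    have := one_add_sq_le_majorant x i
    rw [pow_one, abs_le]
    constructor <;> nlinarith [sq_nonneg (x i - 1), sq_nonneg (x i + 1)]⟩

theorem abs_sq_sub_sq (i j : Fin n) : PolyBounded fun x => |x i ^ 2 - x j ^ 2| :=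
  ⟨1, fun x => by
    have := one_add_sq_le_majorant x i
    have := one_add_sq_le_majorant x j
    rw [pow_one, abs_abs, abs_le]
    constructor <;> nlinarith [sq_nonneg (x i), sq_nonneg (x j)]⟩

theorem sqVandermonde : PolyBounded (n := n) sqVandermonde :=
  prod _ fun i _ => prod _ fun j _ => abs_sq_sub_sq i j

theorem monomial (p : Fin n → ℕ) : PolyBounded fun x : Fin n → ℝ => ∏ i, x i ^ p i :=
  prod _ fun i _ => (eval i).pow _

end PolyBounded

theorem exists_pow_mul_exp_le {c : ℝ} (hc : 0 < c) (N : ℕ) :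
    ∃ K : ℝ, ∀ t : ℝ, (1 + t ^ 2) ^ N * Real.exp (-c * t ^ 2) ≤ K * Real.exp (-(c / 2) * t ^ 2) := by
  -- The constant comes from `u ^ N / N! ≤ exp u` at `u = c / 2 * (1 + t ^ 2)`, which spends half of
  -- the Gaussian.
  refine ⟨N.factorial * (2 / c) ^ N * Real.exp (c / 2), fun t => ?_⟩
  have h := Real.pow_div_factorial_le_exp (c / 2 * (1 + t ^ 2)) (by positivity) N
  rw [div_le_iff₀ (by positivity), mul_pow] at h
  have h2 : (1 + t ^ 2) ^ N ≤ N.factorial * (2 / c) ^ N * Real.exp (c / 2 * (1 + t ^ 2)) := by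
    have h3 := mul_le_mul_of_nonneg_left h (by positivity : (0 : ℝ) ≤ (2 / c) ^ N)
    have h4 : (2 / c) ^ N * ((c / 2) ^ N * (1 + t ^ 2) ^ N) = (1 + t ^ 2) ^ N := by
      rw [← mul_assoc, ← mul_pow]
      field_simp
      simp
    rw [h4] at h3
    linarith
  calc _ ≤ N.factorial * (2 / c) ^ N * Real.exp (c / 2 * (1 + t ^ 2)) * Real.exp (-c * t ^ 2) := by
        gcongr
    _ = _ := by
        rw [mul_assoc, mul_assoc _ (Real.exp (c / 2)), ← Real.exp_add, ← Real.exp_add]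
        ring_nf

theorem integrable_pow_mul_exp {c : ℝ} (hc : 0 < c) (N : ℕ) :
    Integrable (fun t : ℝ => (1 + t ^ 2) ^ N * Real.exp (-c * t ^ 2)) halfLine := by
  obtain ⟨K, hK⟩ := exists_pow_mul_exp_le hc N
  unfold halfLine
  refine Integrable.restrict ?_
  refine ((integrable_exp_neg_mul_sq (half_pos hc)).const_mul K).mono'
    (by fun_prop) (ae_of_all _ fun t => ?_)
  rw [Real.norm_of_nonneg (by positivity)]
  exact hK t

theorem tendsto_pow_mul_exp {c : ℝ} (hc : 0 < c) (N : ℕ) :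
    Tendsto (fun t : ℝ => (1 + t ^ 2) ^ N * Real.exp (-c * t ^ 2)) atTop (𝓝 0) := by
  obtain ⟨K, hK⟩ := exists_pow_mul_exp_le hc N
  refine squeeze_zero (fun t => by positivity) hK ?_
  have h : Tendsto (fun t : ℝ => -(c / 2) * t ^ 2) atTop atBot :=
    (tendsto_pow_atTop two_ne_zero).const_mul_atTop_of_neg (by linarith)
  simpa using (Real.tendsto_exp_atBot.comp h).const_mul K

theorem PolyBounded.integrable {n : ℕ} {f : (Fin n → ℝ) → ℝ} (hf : PolyBounded f)
    (hm : Measurable f) {c : ℝ} (hc : 0 < c) :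
    Integrable (fun x => f x * gauss c x) (orthant n) := by
  obtain ⟨N, hN⟩ := hf
  have h : Integrable (fun x : Fin n → ℝ => ∏ i, (1 + x i ^ 2) ^ N * Real.exp (-c * x i ^ 2))
      (orthant n) := Integrable.fintype_prod fun _ => integrable_pow_mul_exp hc N
  refine h.mono' ?_ (ae_of_all _ fun x => ?_)
  · unfold gauss
    exact (hm.mul (by fun_prop)).aestronglyMeasurable
  · have hg : 0 ≤ gauss c x := Finset.prod_nonneg fun i _ => (Real.exp_pos _).le
    rw [Real.norm_eq_abs, abs_mul, abs_of_nonneg hg, Finset.prod_mul_distrib, Finset.prod_pow]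
    exact mul_le_mul_of_nonneg_right (hN x) hg

theorem measurable_sqVandermonde {n : ℕ} : Measurable (sqVandermonde (n := n)) := by
  unfold sqVandermonde
  fun_prop

theorem sqVandermonde_nonneg {n : ℕ} (x : Fin n → ℝ) : 0 ≤ sqVandermonde x :=
  Finset.prod_nonneg fun _ _ => Finset.prod_nonneg fun _ _ => abs_nonneg _

theorem kernel_nonneg (b : ℕ) (c : ℝ) {n : ℕ} (x : Fin n → ℝ) : 0 ≤ kernel b c x :=
  mul_nonneg (pow_nonneg (sqVandermonde_nonneg x) _)
    (Finset.prod_nonneg fun _ _ => (Real.exp_pos _).le)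

theorem integrable_moment (b : ℕ) {c : ℝ} (hc : 0 < c) {n : ℕ} (p : Fin n → ℕ) :
    Integrable (fun x => (∏ i, x i ^ p i) * kernel b c x) (orthant n) := by
  have h := ((PolyBounded.monomial p).mul (PolyBounded.sqVandermonde.pow b)).integrable
    ((by fun_prop : Measurable fun x : Fin n → ℝ => ∏ i, x i ^ p i).mul
      (measurable_sqVandermonde.pow_const b)) hc
  simpa only [kernel, mul_assoc] using h

/-! ### Positivity and permutation symmetry -/

theorem ae_orthant_pos (n : ℕ) : ∀ᵐ x ∂orthant n, ∀ i, 0 < x i := by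
  rw [ae_all_iff]
  intro i
  have h : ∀ᵐ t ∂halfLine, 0 < t := ae_restrict_mem measurableSet_Ioi
  exact (Measure.tendsto_eval_ae_ae (μ := fun _ : Fin n => halfLine) (i := i)).eventually h

theorem sqVandermonde_eq_abs_det {n : ℕ} (x : Fin n → ℝ) :
    sqVandermonde x = |(Matrix.vandermonde fun i => x i ^ 2).det| := by
  simp only [Matrix.det_vandermonde, Finset.abs_prod, sqVandermonde]
  simp only [abs_sub_comm]

theorem sqVandermonde_comp_perm {n : ℕ} (σ : Equiv.Perm (Fin n)) (x : Fin n → ℝ) :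
    sqVandermonde (fun i => x (σ i)) = sqVandermonde x := by
  rw [sqVandermonde_eq_abs_det, sqVandermonde_eq_abs_det]
  have h : (Matrix.vandermonde fun i => x (σ i) ^ 2)
      = (Matrix.vandermonde fun i => x i ^ 2).submatrix σ id := rfl
  rw [h, Matrix.det_permute, abs_mul]
  rcases Int.units_eq_one_or (Equiv.Perm.sign σ) with h | h <;> simp [h]

theorem kernel_comp_perm (b : ℕ) (c : ℝ) {n : ℕ} (σ : Equiv.Perm (Fin n)) (x : Fin n → ℝ) :
    kernel b c (fun i => x (σ i)) = kernel b c x := by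
  unfold kernel gauss
  rw [sqVandermonde_comp_perm, Equiv.prod_comp σ fun i => Real.exp (-c * x i ^ 2)]

theorem integral_comp_perm {n : ℕ} (σ : Equiv.Perm (Fin n)) (f : (Fin n → ℝ) → ℝ) :
    ∫ x, f (fun i => x (σ i)) ∂orthant n = ∫ x, f x ∂orthant n := by
  have h := measurePreserving_arrowCongr' (fun _ : Fin n => halfLine) (fun _ : Fin n => halfLine)
    σ.symm (MeasurableEquiv.refl ℝ) fun _ => MeasurePreserving.id _
  exact h.integral_comp' f

theorem moment_comp_perm (b : ℕ) (c : ℝ) {n : ℕ} (σ : Equiv.Perm (Fin n)) (p : Fin n → ℕ) :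
    moment b c (fun i => p (σ i)) = moment b c p := by
  unfold moment
  rw [← integral_comp_perm σ]
  refine integral_congr_ae (ae_of_all _ fun x => ?_)
  simp only [kernel_comp_perm]
  rw [Equiv.prod_comp σ fun i => x i ^ p i]

/-! ### Integration by parts in the first variable -/

theorem sqVandermonde_cons {n : ℕ} (t : ℝ) (y : Fin n → ℝ) :
    sqVandermonde (Fin.cons t y : Fin (n + 1) → ℝ) = (∏ j, |t ^ 2 - y j ^ 2|) * sqVandermonde y := by
  unfold sqVandermonde
  rw [Fin.prod_univ_succ, Fin.prod_Ioi_zero]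
  simp [Fin.prod_Ioi_succ]

theorem kernel_cons (b : ℕ) (c : ℝ) {n : ℕ} (t : ℝ) (y : Fin n → ℝ) :
    kernel b c (Fin.cons t y : Fin (n + 1) → ℝ)
      = (∏ j, |t ^ 2 - y j ^ 2| ^ b) * Real.exp (-c * t ^ 2) * kernel b c y := by
  unfold kernel gauss
  rw [sqVandermonde_cons, Fin.prod_univ_succ, mul_pow, Finset.prod_pow]
  simp only [Fin.cons_zero, Fin.cons_succ]
  ring

theorem integral_orthant_succ {n : ℕ} {f : (Fin (n + 1) → ℝ) → ℝ}
    (hf : Integrable f (orthant (n + 1))) :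
    ∫ x, f x ∂orthant (n + 1) = ∫ y, ∫ t, f (Fin.cons t y) ∂halfLine ∂orthant n ∧
      ∀ᵐ y ∂orthant n, Integrable (fun t => f (Fin.cons t y)) halfLine := by
  have h := (measurePreserving_piFinSuccAbove (fun _ : Fin (n + 1) => halfLine) 0).symm
  have hi := (h.integrable_comp_emb (MeasurableEquiv.measurableEmbedding _)).2 hf
  refine ⟨?_, ?_⟩
  · have h1 := h.integral_comp' f
    rw [orthant, ← h1]
    refine (integral_prod_symm _ hi).trans ?_
    simp [orthant, MeasurableEquiv.piFinSuccAbove, Fin.insertNthEquiv]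
  · have h2 := hi.prod_left_ae
    simpa [orthant, MeasurableEquiv.piFinSuccAbove, Fin.insertNthEquiv] using h2

/-- A countable exceptional set is allowed because `|t² - y²| ^ b` may have kinks at `t = ±y`. -/
theorem integral_halfLine_of_hasDerivAt {f f' : ℝ → ℝ} {s : Set ℝ} (hs : s.Countable)
    (hf : Continuous f) (hd : ∀ t, t ∉ s → HasDerivAt f (f' t) t)
    (hi : Integrable f' halfLine) (h0 : Tendsto f atTop (𝓝 0)) :
    ∫ t, f' t ∂halfLine = -f 0 := by
  have h1 := intervalIntegral_tendsto_integral_Ioi 0 hi tendsto_id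
  have h2 : ∀ᶠ B : ℝ in atTop, ∫ t in (0 : ℝ)..B, f' t = f B - f 0 := by
    filter_upwards [eventually_ge_atTop 0] with B hB
    refine integral_eq_of_hasDerivAt_off_countable f f' hs hf.continuousOn
      (fun t ht => hd t ht.2) ?_
    rw [intervalIntegrable_iff_integrableOn_Ioc_of_le hB]
    exact IntegrableOn.mono_set hi Set.Ioc_subset_Ioi_self
  have h3 := tendsto_nhds_unique (h1.congr' h2) (h0.sub_const (f 0))
  simpa [halfLine] using h3

theorem hasDerivAt_abs_pow {b : ℕ} {u : ℝ} (hu : u ≠ 0) :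
    HasDerivAt (fun u : ℝ => |u| ^ b) (b * |u| ^ b / u) u := by
  rcases b with _ | b
  · simpa using hasDerivAt_const u (1 : ℝ)
  refine ((hasDerivAt_abs hu).fun_pow (b + 1)).congr_deriv ?_
  rw [Nat.add_sub_cancel]
  rcases lt_or_gt_of_ne hu with h | h
  · simp only [abs_of_neg h, h, sign_neg]
    field_simp
    simp [pow_succ, mul_comm]
  · simp only [abs_of_pos h, h, sign_pos]
    field_simp
    simp [pow_succ]

theorem hasDerivAt_abs_sq_sub_sq_pow (b : ℕ) {t y : ℝ} (h : t ^ 2 - y ^ 2 ≠ 0) :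
    HasDerivAt (fun t : ℝ => |t ^ 2 - y ^ 2| ^ b)
      (|t ^ 2 - y ^ 2| ^ b * (2 * b * t / (t ^ 2 - y ^ 2))) t := by
  have h1 : HasDerivAt (fun t : ℝ => t ^ 2 - y ^ 2) (2 * t) t := by
    simpa using (hasDerivAt_pow 2 t).sub_const (y ^ 2)
  refine ((hasDerivAt_abs_pow (b := b) h).comp t h1).congr_deriv ?_
  field_simp

theorem hasDerivAt_repulsion (b q : ℕ) (c : ℝ) {n : ℕ} {t : ℝ} {y : Fin n → ℝ}
    (h : ∀ j, t ^ 2 - y j ^ 2 ≠ 0) :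
    HasDerivAt (fun t : ℝ => t ^ q * ((∏ j, |t ^ 2 - y j ^ 2| ^ b) * Real.exp (-c * t ^ 2)))
      ((q * t ^ (q - 1) - 2 * c * t ^ (q + 1) + ∑ j, 2 * b * (t ^ (q + 1) / (t ^ 2 - y j ^ 2))) *
        ((∏ j, |t ^ 2 - y j ^ 2| ^ b) * Real.exp (-c * t ^ 2))) t := by
  have h1 := HasDerivAt.fun_finsetProd (u := Finset.univ)
    (f := fun j t => |t ^ 2 - y j ^ 2| ^ b) (x := t)
    fun j _ => hasDerivAt_abs_sq_sub_sq_pow b (h j)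
  have h2 : HasDerivAt (fun t : ℝ => Real.exp (-c * t ^ 2))
      (Real.exp (-c * t ^ 2) * (-c * (2 * t))) t := by
    simpa using ((hasDerivAt_pow 2 t).const_mul (-c)).exp
  refine ((hasDerivAt_pow q t).mul (h1.mul h2)).congr_deriv ?_
  have h3 : ∑ i, (∏ j ∈ Finset.univ.erase i, |t ^ 2 - y j ^ 2| ^ b) •
      (|t ^ 2 - y i ^ 2| ^ b * (2 * b * t / (t ^ 2 - y i ^ 2)))
      = (∏ j, |t ^ 2 - y j ^ 2| ^ b) * ∑ i, 2 * b * (t / (t ^ 2 - y i ^ 2)) := by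
    rw [Finset.mul_sum]
    refine Finset.sum_congr rfl fun i _ => ?_
    rw [smul_eq_mul, ← mul_assoc, Finset.prod_erase_mul _ _ (Finset.mem_univ i)]
    ring
  have h4 : ∑ j, 2 * (b : ℝ) * (t ^ (q + 1) / (t ^ 2 - y j ^ 2))
      = t ^ q * ∑ i, 2 * b * (t / (t ^ 2 - y i ^ 2)) := by
    rw [Finset.mul_sum]
    refine Finset.sum_congr rfl fun i _ => ?_
    ring
  rw [h3, h4]
  simp only [Pi.mul_apply]
  ring

theorem tendsto_repulsion (b q : ℕ) {c : ℝ} (hc : 0 < c) {n : ℕ} (y : Fin n → ℝ) :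
    Tendsto (fun t : ℝ => t ^ q * ((∏ j, |t ^ 2 - y j ^ 2| ^ b) * Real.exp (-c * t ^ 2)))
      atTop (𝓝 0) := by
  have h := (tendsto_pow_mul_exp hc (q + n * b)).const_mul (∏ j, (1 + y j ^ 2) ^ b)
  rw [mul_zero] at h
  refine squeeze_zero_norm (fun t => ?_) h
  have h1 : |t| ^ q ≤ (1 + t ^ 2) ^ q := by
    refine pow_le_pow_left₀ (abs_nonneg t) ?_ q
    rw [abs_le]
    constructor <;> nlinarith [sq_nonneg (t - 1), sq_nonneg (t + 1)]
  have h2 : ∏ j, |t ^ 2 - y j ^ 2| ^ b ≤ ∏ j, ((1 + y j ^ 2) ^ b * (1 + t ^ 2) ^ b) := by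
    refine Finset.prod_le_prod (fun j _ => by positivity) fun j _ => ?_
    rw [← mul_pow]
    refine pow_le_pow_left₀ (abs_nonneg _) ?_ b
    rw [abs_le]
    constructor <;> nlinarith [sq_nonneg t, sq_nonneg (y j), mul_nonneg (sq_nonneg t) (sq_nonneg (y j))]
  rw [Finset.prod_mul_distrib, Finset.prod_const, Finset.card_univ, Fintype.card_fin] at h2
  have h3 : 0 ≤ ∏ j, |t ^ 2 - y j ^ 2| ^ b := Finset.prod_nonneg fun j _ => by positivity
  rw [Real.norm_eq_abs, abs_mul, abs_mul, abs_of_nonneg h3, abs_pow, abs_of_pos (Real.exp_pos _)]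
  calc _ ≤ (1 + t ^ 2) ^ q * (((∏ j, (1 + y j ^ 2) ^ b) * ((1 + t ^ 2) ^ b) ^ n)
        * Real.exp (-c * t ^ 2)) := by gcongr
    _ = _ := by
        rw [pow_add, mul_comm n b, pow_mul]
        ring

/-- The singular integrals produced by differentiating the repulsion factor. -/
noncomputable def singularMoment (b : ℕ) (c : ℝ) {n : ℕ} (q : ℕ) (p : Fin n → ℕ) (j : Fin n) : ℝ :=
  ∫ x : Fin (n + 1) → ℝ, x 0 ^ (q + 1) * (∏ i, x i.succ ^ p i) * kernel b c x /
    (x 0 ^ 2 - x j.succ ^ 2) ∂orthant (n + 1)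

/-- One Vandermonde factor cancels the denominator up to sign, so the singular terms are integrable
already for `b = 1`. -/
theorem polyBounded_sqVandermonde_div {b : ℕ} (hb : 1 ≤ b) {n : ℕ} (j : Fin n) :
    PolyBounded fun x : Fin (n + 1) → ℝ => sqVandermonde x ^ b / (x 0 ^ 2 - x j.succ ^ 2) := by
  obtain ⟨a, rfl⟩ := Nat.exists_eq_add_of_le' hb
  have h1 : PolyBounded fun x : Fin (n + 1) → ℝ =>
      sqVandermonde x / (x 0 ^ 2 - x j.succ ^ 2) := by
    have h2 : PolyBounded fun x : Fin (n + 1) → ℝ =>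
        (∏ k ∈ Finset.univ.erase j, |x 0 ^ 2 - x k.succ ^ 2|) *
          ∏ i : Fin n, ∏ k ∈ Finset.Ioi i, |x i.succ ^ 2 - x k.succ ^ 2| :=
      (PolyBounded.prod _ fun k _ => PolyBounded.abs_sq_sub_sq _ _).mul
        (PolyBounded.prod _ fun i _ => PolyBounded.prod _ fun k _ =>
          PolyBounded.abs_sq_sub_sq _ _)
    obtain ⟨N, hN⟩ := h2
    refine ⟨N, fun x => le_trans ?_ (hN x)⟩
    beta_reduce
    unfold sqVandermonde
    rw [Fin.prod_univ_succ, Fin.prod_Ioi_zero,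
      ← Finset.mul_prod_erase _ _ (Finset.mem_univ j)]
    simp only [Fin.prod_Ioi_succ]
    rw [abs_div, mul_assoc, abs_mul, abs_abs, mul_div_assoc, mul_comm, div_mul_eq_mul_div]
    exact div_le_of_le_mul₀ (abs_nonneg _) (abs_nonneg _) le_rfl
  have h2 := (PolyBounded.sqVandermonde (n := n + 1)).pow a |>.mul h1
  simpa only [pow_succ, mul_div_assoc] using h2

theorem integrable_singularMoment {b : ℕ} (hb : 1 ≤ b) {c : ℝ} (hc : 0 < c) {n : ℕ} (q : ℕ)
    (p : Fin n → ℕ) (j : Fin n) :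
    Integrable (fun x : Fin (n + 1) → ℝ => x 0 ^ (q + 1) * (∏ i, x i.succ ^ p i) * kernel b c x /
      (x 0 ^ 2 - x j.succ ^ 2)) (orthant (n + 1)) := by
  have h := ((((PolyBounded.eval 0).pow (q + 1)).mul
    (PolyBounded.prod Finset.univ fun i _ => (PolyBounded.eval (Fin.succ i)).pow (p i))).mul
    (polyBounded_sqVandermonde_div hb j)).integrable
    ((by fun_prop : Measurable fun x : Fin (n + 1) → ℝ =>
        x 0 ^ (q + 1) * ∏ i : Fin n, x i.succ ^ p i).mul
      ((measurable_sqVandermonde.pow_const b).div (by fun_prop))) hc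
  refine h.congr (ae_of_all _ fun x => ?_)
  simp only [kernel]
  ring

/-- The left side integrates the `x_0`-derivative of the integrand with exponent `q` at `x_0`. The
right side is its boundary value at `x_0 = 0`, where the repulsion becomes `∏ y_j ^ (2b)`; it
survives only for `q = 0`. The truncated `q - 1` is harmless, as its coefficient is then 0. -/
theorem integration_by_parts {b : ℕ} (hb : 1 ≤ b) {c : ℝ} (hc : 0 < c) {n : ℕ} (q : ℕ)
    (p : Fin n → ℕ) :
    q * moment b c (Fin.cons (q - 1) p : Fin (n + 1) → ℕ)
        - 2 * c * moment b c (Fin.cons (q + 1) p : Fin (n + 1) → ℕ)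
        + ∑ j, 2 * b * singularMoment b c q p j
      = -(0 ^ q * moment b c fun j => p j + 2 * b) := by
  have i1 := (integrable_moment b hc (Fin.cons (q - 1) p : Fin (n + 1) → ℕ)).const_mul (q : ℝ)
  have i2 := (integrable_moment b hc (Fin.cons (q + 1) p : Fin (n + 1) → ℕ)).const_mul (2 * c)
  have i3 := fun j => (integrable_singularMoment hb hc q p j).const_mul (2 * (b : ℝ))
  have i4 := integrable_finsetSum Finset.univ fun j _ => i3 j
  -- Applied to the whole sum, so that almost every slice of the full derivative is integrable.
  have h := integral_orthant_succ ((i1.sub i2).add i4)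
  have h1 := h.1
  rw [integral_add' (i1.sub i2) i4, integral_sub' i1 i2,
    integral_finsetSum _ fun j _ => i3 j] at h1
  simp only [integral_const_mul, Pi.add_apply, Pi.sub_apply] at h1
  unfold moment singularMoment
  rw [h1, ← integral_const_mul, ← integral_neg]
  refine integral_congr_ae ?_
  filter_upwards [h.2] with y hy
  set A := (∏ i, y i ^ p i) * kernel b c y with hA
  have key := integral_halfLine_of_hasDerivAt
    (f := fun t => A * (t ^ q * ((∏ j, |t ^ 2 - y j ^ 2| ^ b) * Real.exp (-c * t ^ 2))))
    (s := (Set.range y) ∪ Set.range fun j => -y j)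
    (((Set.finite_range _).union (Set.finite_range _)).countable) (by fun_prop)
    (fun t ht => (hasDerivAt_repulsion b q c (fun j hj => ht ?_)).const_mul A) ?_ ?_
  · refine Eq.trans (integral_congr_ae (ae_of_all _ fun t => ?_)) (key.trans ?_)
    · simp only [Fin.prod_univ_succ, Fin.cons_zero, Fin.cons_succ, kernel_cons, hA, mul_add,
        add_mul, mul_sub, sub_mul, Finset.mul_sum, Finset.sum_mul]
      congr 1
      · ring
      · refine Finset.sum_congr rfl fun j _ => ?_
        ring
    · simp only [hA, pow_add, Finset.prod_mul_distrib, Finset.prod_pow, pow_mul]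
      simp [Finset.prod_pow]
      ring
  · rcases sq_eq_sq_iff_eq_or_eq_neg.1 (sub_eq_zero.1 hj) with h | h
    · exact Or.inl ⟨j, h.symm⟩
    · exact Or.inr ⟨j, h.symm⟩
  · refine hy.congr (ae_of_all _ fun t => ?_)
    simp only [Pi.add_apply, Pi.sub_apply, Fin.prod_univ_succ, Fin.cons_zero, Fin.cons_succ, kernel_cons, hA, mul_add,
        add_mul, mul_sub, sub_mul, Finset.mul_sum, Finset.sum_mul]
    congr 1
    · ring
    · refine Finset.sum_congr rfl fun j _ => ?_
      ring
  · simpa using (tendsto_repulsion b q hc y).const_mul A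

/-! ### Evaluating the singular terms by exchanging two variables -/

theorem prod_comp_swap_pow {n : ℕ} (i j : Fin n) (x : Fin n → ℝ) (r : Fin n → ℕ) :
    ∏ k, x (Equiv.swap i j k) ^ r k = ∏ k, x k ^ r (Equiv.swap i j k) := by
  rw [← Equiv.prod_comp (Equiv.swap i j) fun k => x k ^ r (Equiv.swap i j k)]
  simp

theorem singularMoment_eq (b : ℕ) (c : ℝ) {n : ℕ} (q : ℕ) (p : Fin n → ℕ) (j : Fin n) :
    singularMoment b c q p j = ∫ x : Fin (n + 1) → ℝ,
      (∏ i, x i ^ (Fin.cons (q + 1) p : Fin (n + 1) → ℕ) i) * kernel b c x /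
        (x 0 ^ 2 - x j.succ ^ 2) ∂orthant (n + 1) := by
  simp [singularMoment, Fin.prod_univ_succ]

theorem singularMoment_swap (b : ℕ) (c : ℝ) {n : ℕ} (q : ℕ) (p : Fin n → ℕ) (j : Fin n) :
    singularMoment b c q p j = -∫ x : Fin (n + 1) → ℝ,
      (∏ i, x i ^ (Fin.cons (q + 1) p : Fin (n + 1) → ℕ) (Equiv.swap 0 j.succ i)) *
        kernel b c x / (x 0 ^ 2 - x j.succ ^ 2) ∂orthant (n + 1) := by
  rw [singularMoment_eq, ← integral_comp_perm (Equiv.swap 0 j.succ), ← integral_neg]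
  refine integral_congr_ae (ae_of_all _ fun x => ?_)
  simp only [prod_comp_swap_pow, kernel_comp_perm, Equiv.swap_apply_left, Equiv.swap_apply_right]
  rw [← neg_sub (x 0 ^ 2), div_neg]

/-- With equal exponents at `x_0` and `x_j` the integrand is antisymmetric under their exchange. -/
theorem singularMoment_eq_zero (b : ℕ) (c : ℝ) {n : ℕ} {q : ℕ} {p : Fin n → ℕ} {j : Fin n}
    (h : p j = q + 1) : singularMoment b c q p j = 0 := by
  have h1 := singularMoment_swap b c q p j
  have h2 : ∀ i, (Fin.cons (q + 1) p : Fin (n + 1) → ℕ) (Equiv.swap 0 j.succ i)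
      = (Fin.cons (q + 1) p : Fin (n + 1) → ℕ) i := by
    intro i
    rw [Equiv.swap_apply_def]
    split_ifs with h3 h4
    · simp [h3, h]
    · simp [h4, h]
    · rfl
  simp only [h2] at h1
  rw [← singularMoment_eq] at h1
  linarith

theorem kernel_mul_div_cancel {b : ℕ} (hb : 1 ≤ b) (c : ℝ) {n : ℕ} (x : Fin (n + 1) → ℝ)
    (j : Fin n) :
    kernel b c x * ((x 0 ^ 2 - x j.succ ^ 2) / (x 0 ^ 2 - x j.succ ^ 2)) = kernel b c x := by
  by_cases h : x 0 ^ 2 - x j.succ ^ 2 = 0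
  · have hV : sqVandermonde x = 0 := by
      unfold sqVandermonde
      refine Finset.prod_eq_zero (Finset.mem_univ 0) (Finset.prod_eq_zero
        (Finset.mem_Ioi.2 (Fin.succ_pos j)) ?_)
      rw [h, abs_zero]
    simp [kernel, hV, Nat.one_le_iff_ne_zero.1 hb]
  · rw [div_self h, mul_one]

/-- Averaging the integrand with its exchanged copy turns the numerator `x_0²` into `(x_0² - x_j²) /
2`, which cancels the denominator. -/
theorem two_mul_singularMoment {b : ℕ} (hb : 1 ≤ b) {c : ℝ} (hc : 0 < c) {n : ℕ} {q : ℕ}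
    {p : Fin n → ℕ} {j : Fin n} (h : p j = q) :
    2 * singularMoment b c (q + 1) p j = moment b c (Fin.cons q p : Fin (n + 1) → ℕ) := by
  set r : Fin (n + 1) → ℕ := Fin.cons q p with hr
  have h1 : ∀ x : Fin (n + 1) → ℝ, ∏ i, x i ^ (Fin.cons (q + 1 + 1) p : Fin (n + 1) → ℕ) i
      = (∏ i, x i ^ r i) * x 0 ^ 2 := by
    intro x
    simp only [hr, Fin.prod_univ_succ, Fin.cons_zero, Fin.cons_succ]
    ring
  have h2 : ∀ x : Fin (n + 1) → ℝ,
      ∏ i, x i ^ (Fin.cons (q + 1 + 1) p : Fin (n + 1) → ℕ) (Equiv.swap 0 j.succ i)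
      = (∏ i, x i ^ r i) * x j.succ ^ 2 := by
    intro x
    rw [← prod_comp_swap_pow, h1]
    rw [prod_comp_swap_pow, Equiv.swap_apply_left]
    congr 1
    refine Finset.prod_congr rfl fun i _ => ?_
    congr 1
    rw [Equiv.swap_apply_def]
    split_ifs with h3 h4
    · simp [h3, h, hr]
    · simp [h4, h, hr]
    · rfl
  have i1 : Integrable (fun x : Fin (n + 1) → ℝ => (∏ i, x i ^ r i) * x 0 ^ 2 * kernel b c x /
      (x 0 ^ 2 - x j.succ ^ 2)) (orthant (n + 1)) := by
    refine (integrable_singularMoment hb hc (q + 1) p j).congr (ae_of_all _ fun x => ?_)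
    simp only [← h1]
    simp only [Fin.prod_univ_succ, Fin.cons_zero, Fin.cons_succ]
  have e1 := singularMoment_eq b c (q + 1) p j
  have e2 := singularMoment_swap b c (q + 1) p j
  have e3 : moment b c r = ∫ x : Fin (n + 1) → ℝ, ((∏ i, x i ^ r i) * x 0 ^ 2 * kernel b c x /
        (x 0 ^ 2 - x j.succ ^ 2) - (∏ i, x i ^ r i) * x j.succ ^ 2 * kernel b c x /
        (x 0 ^ 2 - x j.succ ^ 2)) ∂orthant (n + 1) := by
    refine integral_congr_ae (ae_of_all _ fun x => ?_)
    beta_reduce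
    rw [← kernel_mul_div_cancel hb c x j]
    conv_rhs => rw [kernel_mul_div_cancel hb c x j]
    ring
  simp only [h1] at e1
  simp only [h2] at e2
  rw [integral_sub] at e3
  · linarith
  · exact i1
  · have i3 := (((PolyBounded.monomial r).mul ((PolyBounded.eval j.succ).pow 2)).mul
      (polyBounded_sqVandermonde_div hb j)).integrable
      ((by fun_prop : Measurable fun x : Fin (n + 1) → ℝ => (∏ i, x i ^ r i) * x j.succ ^ 2).mul
      ((measurable_sqVandermonde.pow_const b).div (by fun_prop))) hc
    refine i3.congr (ae_of_all _ fun x => ?_)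
    simp only [kernel]
    ring

/-! ### The two recurrences for the moments -/

/-- The exponents `α + 2` on `T` and `α` elsewhere. -/
def raised {n : ℕ} (α : ℕ) (T : Finset (Fin n)) (i : Fin n) : ℕ := if i ∈ T then α + 2 else α

/-- Integration by parts with `q = α + 1`: indices already in `T` contribute nothing, and each of
the other `n - T.card` contributes `b` copies of the moment. -/
theorem moment_raised_insert_zero {b : ℕ} (hb : 1 ≤ b) {c : ℝ} (hc : 0 < c) {n : ℕ} (α : ℕ)
    {T : Finset (Fin (n + 1))} (hT : 0 ∉ T) :
    2 * c * moment b c (raised α (insert 0 T)) =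
      (α + 1 + b * (n - T.card)) * moment b c (raised α T) := by
  have h := integration_by_parts hb hc (α + 1) fun j : Fin n => raised α T j.succ
  have h1 : (Fin.cons (α + 1 - 1) fun j : Fin n => raised α T j.succ) = raised α T := by
    funext i
    refine Fin.cases ?_ (fun j => ?_) i <;> simp [raised, hT]
  have h2 : (Fin.cons (α + 1 + 1) fun j : Fin n => raised α T j.succ)
      = raised α (insert 0 T) := by
    funext i
    refine Fin.cases ?_ (fun j => ?_) i <;> simp [raised]
  have h3 : ∀ j, 2 * (b : ℝ) * singularMoment b c (α + 1) (fun j : Fin n => raised α T j.succ) j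
      = b * moment b c (raised α T) * (1 - if j.succ ∈ T then 1 else 0) := by
    intro j
    by_cases hj : j.succ ∈ T
    · rw [singularMoment_eq_zero b c (by simp [raised, hj])]
      simp [hj]
    · have h4 := two_mul_singularMoment hb hc (q := α)
        (p := fun j : Fin n => raised α T j.succ) (j := j) (by simp [raised, hj])
      rw [Nat.add_sub_cancel] at h1
      rw [h1] at h4
      rw [← h4]
      simp only [hj, if_false]
      ring
  have h5 : ∑ j : Fin n, (if j.succ ∈ T then (1 : ℝ) else 0) = T.card := by
    have h6 : ∑ j : Fin (n + 1), (if j ∈ T then (1 : ℝ) else 0) = T.card := by simp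
    rw [← h6, Fin.sum_univ_succ]
    simp [hT]
  simp only [h1, h2, h3] at h
  rw [← Finset.mul_sum, Finset.sum_sub_distrib, h5] at h
  simp only [Finset.sum_const, Finset.card_univ, Fintype.card_fin] at h
  simp at h
  linarith

theorem moment_raised_insert {b : ℕ} (hb : 1 ≤ b) {c : ℝ} (hc : 0 < c) {n : ℕ} (α : ℕ)
    {T : Finset (Fin n)} {i : Fin n} (hi : i ∉ T) :
    2 * c * moment b c (raised α (insert i T)) =
      (α + 1 + b * (n - 1 - T.card)) * moment b c (raised α T) := by
  obtain ⟨n, rfl⟩ : ∃ m, n = m + 1 := ⟨n - 1, by have := i.pos; omega⟩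
  have h0 : ∀ T : Finset (Fin (n + 1)), moment b c (raised α (T.map (Equiv.swap 0 i).toEmbedding))
      = moment b c (raised α T) := by
    intro T
    rw [← moment_comp_perm b c (Equiv.swap 0 i)]
    congr 1
    funext k
    simp [raised]
  have h := moment_raised_insert_zero hb hc α (T := T.map (Equiv.swap 0 i).toEmbedding) (by
    rw [Finset.mem_map_equiv]
    simpa using hi)
  have h1 : insert 0 (T.map (Equiv.swap 0 i).toEmbedding)
      = (insert i T).map (Equiv.swap 0 i).toEmbedding := by
    rw [Finset.map_insert]
    simp
  rw [h1, h0, h0, Finset.card_map] at h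
  rw [h]
  push_cast
  ring

/-- The moment with constant exponent. -/
noncomputable def uniformMoment (b : ℕ) (c : ℝ) (α n : ℕ) : ℝ := moment b c fun _ : Fin n => α

theorem uniformMoment_add_two {b : ℕ} (hb : 1 ≤ b) {c : ℝ} (hc : 0 < c) (α n : ℕ) :
    uniformMoment b c (α + 2) n =
      (∏ j ∈ Finset.range n, ((α + 1 + b * j) / (2 * c))) * uniformMoment b c α n := by
  have h : ∀ T : Finset (Fin n), moment b c (raised α T) =
      (∏ j ∈ Finset.range T.card, ((α + 1 + b * (n - 1 - j)) / (2 * c))) *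
        uniformMoment b c α n := by
    intro T
    induction T using Finset.induction_on with
    | empty =>
      have h0 : raised α (∅ : Finset (Fin n)) = fun _ => α := by
        funext i
        simp [raised]
      simp [h0, uniformMoment]
    | insert i T hi ih =>
      have h1 := moment_raised_insert hb hc α hi
      rw [Finset.card_insert_of_notMem hi, Finset.prod_range_succ]
      rw [ih] at h1
      field_simp at h1 ⊢
      linarith
  have h1 := h Finset.univ
  have h2 : raised α (Finset.univ : Finset (Fin n)) = fun _ => α + 2 := by
    funext i
    simp [raised]
  rw [h2, Finset.card_univ, Fintype.card_fin] at h1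
  rw [uniformMoment, h1, ← Finset.prod_range_reflect]
  congr 1
  refine Finset.prod_congr rfl fun j hj => ?_
  have := Finset.mem_range.1 hj
  rw [Nat.cast_sub (by omega), Nat.cast_sub (by omega)]
  push_cast
  ring

/-- The case `q = 0` with all other exponents 1: every singular term vanishes, and the boundary term
has one variable fewer. -/
theorem uniformMoment_one_succ {b : ℕ} (hb : 1 ≤ b) {c : ℝ} (hc : 0 < c) (n : ℕ) :
    2 * c * uniformMoment b c 1 (n + 1) = uniformMoment b c (1 + 2 * b) n := by
  have h := integration_by_parts hb hc 0 fun _ : Fin n => 1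
  have h1 : (Fin.cons (0 + 1) fun _ : Fin n => 1 : Fin (n + 1) → ℕ) = fun _ => 1 := by
    funext i
    refine Fin.cases ?_ (fun j => ?_) i <;> simp
  simp only [h1, singularMoment_eq_zero b c (q := 0) (p := fun _ : Fin n => 1) rfl] at h
  simp at h
  exact h

/-! ### Log-convexity and positivity of the moments -/

theorem uniformMoment_zero (b : ℕ) (c : ℝ) (α : ℕ) : uniformMoment b c α 0 = 1 := by
  simp [uniformMoment, moment, kernel, sqVandermonde, gauss, orthant, Measure.real]

theorem uniformMoment_nonneg (b : ℕ) (c : ℝ) (α n : ℕ) : 0 ≤ uniformMoment b c α n := by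
  refine integral_nonneg_of_ae ?_
  filter_upwards [ae_orthant_pos n] with x hx
  exact mul_nonneg (Finset.prod_nonneg fun i _ => pow_nonneg (hx i).le _) (kernel_nonneg b c x)

/-- Cauchy-Schwarz, as the discriminant of the integral of `(s ∏ x_i + 1)²` against the weight of
exponent `α`. -/
theorem uniformMoment_sq_le (b : ℕ) {c : ℝ} (hc : 0 < c) (α n : ℕ) :
    uniformMoment b c (α + 1) n ^ 2 ≤ uniformMoment b c α n * uniformMoment b c (α + 2) n := by
  have hquad : ∀ s : ℝ, 0 ≤ uniformMoment b c (α + 2) n * (s * s)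
      + (2 * uniformMoment b c (α + 1) n) * s + uniformMoment b c α n := by
    intro s
    have i0 := integrable_moment b hc fun _ : Fin n => α
    have i1 := integrable_moment b hc fun _ : Fin n => α + 1
    have i2 := integrable_moment b hc fun _ : Fin n => α + 2
    unfold uniformMoment moment
    have h : 0 ≤ ∫ x, ((s * s) * ((∏ i, x i ^ (α + 2)) * kernel b c x)
        + (2 * s) * ((∏ i, x i ^ (α + 1)) * kernel b c x)
        + (∏ i, x i ^ α) * kernel b c x) ∂orthant n := by
      refine integral_nonneg_of_ae ?_
      filter_upwards [ae_orthant_pos n] with x hx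
      have h1 : 0 ≤ (∏ i, x i ^ α) * kernel b c x :=
        mul_nonneg (Finset.prod_nonneg fun i _ => pow_nonneg (hx i).le _) (kernel_nonneg b c x)
      have h2 := mul_nonneg h1 (sq_nonneg (s * (∏ i, x i) + 1))
      simp only [pow_add, Finset.prod_mul_distrib, Finset.prod_pow, Pi.zero_apply, pow_one]
        at h2 ⊢
      linarith
    have i2' := i2.const_mul (s * s)
    have i1' := i1.const_mul (2 * s)
    have i3 : Integrable (fun x : Fin n → ℝ => (s * s) * ((∏ i, x i ^ (α + 2)) * kernel b c x)
        + (2 * s) * ((∏ i, x i ^ (α + 1)) * kernel b c x)) (orthant n) := i2'.add i1'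
    rw [integral_add i3 i0, integral_add i2' i1', integral_const_mul,
      integral_const_mul] at h
    linarith
  have h := discrim_le_zero hquad
  unfold discrim at h
  nlinarith

theorem uniformMoment_one_pos {b : ℕ} (hb : 1 ≤ b) {c : ℝ} (hc : 0 < c) (n : ℕ) :
    0 < uniformMoment b c 1 n := by
  induction n with
  | zero => simp [uniformMoment_zero]
  | succ n ih =>
    have h : ∀ k, 0 < uniformMoment b c (1 + 2 * k) n := by
      intro k
      induction k with
      | zero => simpa using ih
      | succ k ihk =>
        rw [show 1 + 2 * (k + 1) = 1 + 2 * k + 2 by ring, uniformMoment_add_two hb hc]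
        exact mul_pos (Finset.prod_pos fun j _ => by positivity) ihk
    have h1 := h b
    rw [← uniformMoment_one_succ hb hc] at h1
    exact pos_of_mul_pos_right h1 (by positivity)

/-! ### Factorial recurrences for exponent 1 -/

theorem prod_range_add_one (n : ℕ) : ∏ j ∈ Finset.range n, ((j : ℝ) + 1) = n.factorial := by
  rw [← Finset.prod_range_add_one_eq_factorial]
  push_cast
  rfl

theorem prod_range_add_two (n : ℕ) :
    ∏ j ∈ Finset.range n, ((j : ℝ) + 2) = (n + 1).factorial := by
  rw [← prod_range_add_one, Finset.prod_range_succ']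
  simp [add_assoc, one_add_one_eq_two]

theorem uniformMoment_one_one_succ {c : ℝ} (hc : 0 < c) (n : ℕ) :
    uniformMoment 1 c 1 (n + 1) =
      (n + 1).factorial / (2 * c) ^ (n + 1) * uniformMoment 1 c 1 n := by
  have h := uniformMoment_one_succ le_rfl hc n
  have h2 : ∏ j ∈ Finset.range n, (((1 : ℕ) + 1 + (1 : ℕ) * j) / (2 * c) : ℝ)
      = (n + 1).factorial / (2 * c) ^ n := by
    rw [Finset.prod_div_distrib, ← prod_range_add_two]
    simp only [Finset.prod_const, Finset.card_range]
    congr 1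
    exact Finset.prod_congr rfl fun j _ => by push_cast; ring
  rw [show 1 + 2 * 1 = 1 + 2 by rfl, uniformMoment_add_two le_rfl hc, h2] at h
  rw [pow_succ]
  field_simp at h ⊢
  linarith

theorem prod_two_add_two_mul {c : ℝ} (hc : 0 < c) (n : ℕ) :
    ∏ j ∈ Finset.range n, (((1 : ℕ) + 1 + (2 : ℕ) * j) / (2 * c) : ℝ)
      = n.factorial / c ^ n := by
  rw [← prod_range_add_one, show c ^ n = ∏ _j ∈ Finset.range n, c by simp,
    ← Finset.prod_div_distrib]
  refine Finset.prod_congr rfl fun j _ => ?_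
  push_cast
  field_simp
  ring

theorem uniformMoment_two_one_succ {c : ℝ} (hc : 0 < c) (n : ℕ) :
    uniformMoment 2 c 1 (n + 1) =
      (n + 1).factorial * n.factorial / (2 * c ^ (2 * n + 1)) * uniformMoment 2 c 1 n := by
  have h := uniformMoment_one_succ one_le_two hc n
  have h2 : ∏ j ∈ Finset.range n, (((3 : ℕ) + 1 + (2 : ℕ) * j) / (2 * c) : ℝ)
      = (n + 1).factorial / c ^ n := by
    rw [← prod_range_add_two, show c ^ n = ∏ _j ∈ Finset.range n, c by simp,
      ← Finset.prod_div_distrib]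
    refine Finset.prod_congr rfl fun j _ => ?_
    push_cast
    field_simp
    ring
  rw [show 1 + 2 * 2 = 3 + 2 by rfl, uniformMoment_add_two one_le_two hc, h2,
    show 3 = 1 + 2 by rfl, uniformMoment_add_two one_le_two hc, prod_two_add_two_mul hc] at h
  rw [show 2 * n + 1 = n + n + 1 by ring, pow_succ, pow_add]
  field_simp at h ⊢
  linarith

/-- The increment of the logarithm of `uniformMoment b 1 1`. -/
noncomputable def logIncrement (b n : ℕ) : ℝ :=
  if b = 1 then Real.log (n + 1).factorial - (n + 1) * Real.log 2
  else Real.log (n + 1).factorial + Real.log n.factorial - Real.log 2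

theorem log_uniformMoment_one_succ {b : ℕ} (hb : b = 1 ∨ b = 2) {c : ℝ} (hc : 0 < c) (n : ℕ) :
    Real.log (uniformMoment b c 1 (n + 1)) =
      Real.log (uniformMoment b c 1 n) + logIncrement b n - (1 + b * n) * Real.log c := by
  have hf : ∀ m : ℕ, (m.factorial : ℝ) ≠ 0 := fun m => by positivity
  rcases hb with rfl | rfl
  · have h := (uniformMoment_one_pos le_rfl hc n).ne'
    rw [uniformMoment_one_one_succ hc, Real.log_mul (by positivity) h,
      Real.log_div (hf _) (by positivity), Real.log_pow, Real.log_mul two_ne_zero hc.ne']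
    simp only [logIncrement, if_true]
    push_cast
    ring
  · have h := (uniformMoment_one_pos one_le_two hc n).ne'
    rw [uniformMoment_two_one_succ hc, Real.log_mul (by positivity) h,
      Real.log_div (by positivity) (by positivity), Real.log_mul (hf _) (hf _),
      Real.log_mul two_ne_zero (by positivity), Real.log_pow]
    simp [logIncrement]
    ring

/-- This is the homogeneity under `x ↦ x / √c`, read off from the recurrence instead of a
substitution. -/
theorem log_uniformMoment_one {b : ℕ} (hb : b = 1 ∨ b = 2) {c : ℝ} (hc : 0 < c) (n : ℕ) :
    Real.log (uniformMoment b c 1 n) =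
      Real.log (uniformMoment b 1 1 n) - (n + b * (n * (n - 1)) / 2) * Real.log c := by
  induction n with
  | zero => simp [uniformMoment_zero]
  | succ n ih =>
    rw [log_uniformMoment_one_succ hb hc, ih, log_uniformMoment_one_succ hb one_pos, Real.log_one]
    push_cast
    ring

/-! ### Comparing exponents 0 and 2 with exponent 1 -/

theorem inv_two_mul_le_prod {n : ℕ} (hn : 1 ≤ n) :
    (2 * (n : ℝ))⁻¹ ≤ ∏ j ∈ Finset.range n, (((j : ℝ) + 1 / 2) / (j + 1)) := by
  induction n, hn using Nat.le_induction with
  | base => norm_num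
  | succ n hn ih =>
    have h : (0 : ℝ) < n := by exact_mod_cast hn
    rw [Finset.prod_range_succ]
    calc (2 * ((n + 1 : ℕ) : ℝ))⁻¹ = (2 * (n : ℝ))⁻¹ * (n / (n + 1)) := by
          push_cast
          field_simp
      _ ≤ _ := by gcongr; linarith

theorem prod_one_add_two_mul {c : ℝ} (hc : 0 < c) (n : ℕ) :
    ∏ j ∈ Finset.range n, (((0 : ℕ) + 1 + (2 : ℕ) * j) / (2 * c) : ℝ)
      = (∏ j ∈ Finset.range n, (((j : ℝ) + 1 / 2) / (j + 1))) * (n.factorial / c ^ n) := by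
  rw [← prod_two_add_two_mul hc, ← Finset.prod_mul_distrib]
  refine Finset.prod_congr rfl fun j _ => ?_
  push_cast
  field_simp
  ring

theorem uniformMoment_two_zero_pos_and_two_pos {c : ℝ} (hc : 0 < c) (n : ℕ) :
    0 < uniformMoment 2 c 0 n ∧ 0 < uniformMoment 2 c 2 n := by
  have h := uniformMoment_sq_le 2 hc 0 n
  have h1 := pow_pos (uniformMoment_one_pos one_le_two hc n) 2
  have h0 := uniformMoment_nonneg 2 c 0 n
  have h2 := uniformMoment_nonneg 2 c 2 n
  have h3 : 0 < uniformMoment 2 c 0 n * uniformMoment 2 c 2 n := h1.trans_le h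
  exact ⟨pos_of_mul_pos_left h3 h2, pos_of_mul_pos_right h3 h0⟩

/-- The pairs of exponents which occur in the symmetry classes. -/
def Admissible (b α : ℕ) : Prop := (b = 1 ∧ α = 1) ∨ (b = 2 ∧ (α = 0 ∨ α = 2))

theorem Admissible.uniformMoment_pos {b α : ℕ} (h : Admissible b α) {c : ℝ} (hc : 0 < c) (n : ℕ) :
    0 < uniformMoment b c α n := by
  rcases h with ⟨rfl, rfl⟩ | ⟨rfl, rfl | rfl⟩
  · exact uniformMoment_one_pos le_rfl hc n
  · exact (uniformMoment_two_zero_pos_and_two_pos hc n).1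
  · exact (uniformMoment_two_zero_pos_and_two_pos hc n).2

/-- For `b = 2`, raising by 2 multiplies `M_1` by `F = n! / c ^ n` and `M_0` by `R F` with `R ≥ 1 /
(2n)`. Log-convexity between exponents 0, 1, 2 and 1, 2, 3 then shows that each unit of `α` costs a
factor `√F`, up to powers of `R`. -/
theorem Admissible.abs_log_uniformMoment_sub_le {b α : ℕ} (h : Admissible b α) {c : ℝ}
    (hc : 0 < c) {n : ℕ} (hn : 1 ≤ n) :
    |Real.log (uniformMoment b c α n) - Real.log (uniformMoment b c 1 n)
      - (α - 1) / 2 * (Real.log n.factorial - n * Real.log c)| ≤ Real.log (2 * n) := by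
  have hn' : (1 : ℝ) ≤ n := by exact_mod_cast hn
  have hlog : 0 ≤ Real.log (2 * n) := Real.log_nonneg (by linarith)
  rcases h with ⟨rfl, rfl⟩ | ⟨rfl, h⟩
  · simpa using hlog
  have p1 := uniformMoment_one_pos one_le_two hc n
  obtain ⟨p0, p2⟩ := uniformMoment_two_zero_pos_and_two_pos hc n
  set R := ∏ j ∈ Finset.range n, (((j : ℝ) + 1 / 2) / (j + 1)) with hR
  have hRpos : 0 < R := Finset.prod_pos fun j _ => by positivity
  have l0 : -Real.log (2 * n) ≤ Real.log R := by
    rw [← Real.log_inv]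
    exact Real.log_le_log (by positivity) (inv_two_mul_le_prod hn)
  have lF : Real.log (n.factorial / c ^ n) = Real.log n.factorial - n * Real.log c := by
    rw [Real.log_div (by positivity) (by positivity), Real.log_pow]
  have hF : 0 < (n.factorial / c ^ n : ℝ) := by positivity
  have l1 : 2 * Real.log (uniformMoment 2 c 1 n) ≤
      Real.log (uniformMoment 2 c 0 n) + Real.log (uniformMoment 2 c 2 n) := by
    rw [← Real.log_mul p0.ne' p2.ne']
    have := Real.log_le_log (by positivity) (uniformMoment_sq_le 2 hc 0 n)
    rwa [Real.log_pow] at this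
  have l2 : 2 * Real.log (uniformMoment 2 c 2 n) ≤
      2 * Real.log (uniformMoment 2 c 1 n) + (Real.log n.factorial - n * Real.log c) := by
    have h3 := uniformMoment_add_two one_le_two hc 1 n
    rw [prod_two_add_two_mul hc] at h3
    have := Real.log_le_log (by positivity) (uniformMoment_sq_le 2 hc 1 n)
    rw [h3, Real.log_pow, Real.log_mul p1.ne' (by positivity), Real.log_mul hF.ne' p1.ne', lF]
      at this
    push_cast at this
    linarith
  have l3 : Real.log (uniformMoment 2 c 2 n) = Real.log R
      + (Real.log n.factorial - n * Real.log c) + Real.log (uniformMoment 2 c 0 n) := by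
    have h3 := uniformMoment_add_two one_le_two hc 0 n
    rw [prod_one_add_two_mul hc, ← hR, zero_add] at h3
    rw [h3, Real.log_mul (by positivity) p0.ne', Real.log_mul hRpos.ne' hF.ne', lF]
  rw [abs_le]
  rcases h with rfl | rfl <;> push_cast <;> constructor <;> linarith

/-! ### Asymptotics -/

theorem tendsto_log_div : Tendsto (fun n : ℕ => Real.log n / n) atTop (𝓝 0) := by
  have h := Real.tendsto_pow_log_div_mul_add_atTop 1 0 1 one_ne_zero
  simpa [Function.comp_def] using h.comp tendsto_natCast_atTop_atTop

theorem tendsto_log_factorial :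
    Tendsto (fun n : ℕ => Real.log n.factorial / n - Real.log n) atTop (𝓝 (-1)) := by
  have h1 : Tendsto (fun n : ℕ => Real.log (Stirling.stirlingSeq n)) atTop
      (𝓝 (Real.log √Real.pi)) :=
    (Real.continuousAt_log (by positivity)).tendsto.comp Stirling.tendsto_stirlingSeq_sqrt_pi
  have h2 : Tendsto (fun n : ℕ => (1 : ℝ) / n) atTop (𝓝 0) := tendsto_one_div_atTop_nhds_zero_nat
  have h3 := (((h1.add_const (1 / 2 * Real.log 2)).mul h2).add
    (tendsto_log_div.const_mul (1 / 2))).sub_const 1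
  simp only [mul_zero, add_zero, zero_sub] at h3
  refine h3.congr' ?_
  filter_upwards [eventually_ge_atTop 1] with n hn
  have hn' : (n : ℝ) ≠ 0 := by positivity
  rw [Stirling.log_stirlingSeq_formula, Real.log_mul two_ne_zero hn',
    Real.log_div hn' (Real.exp_ne_zero 1), Real.log_exp]
  field_simp
  ring

theorem tendsto_mul_log_succ_sub :
    Tendsto (fun n : ℕ => (n : ℝ) * (Real.log (n + 1) - Real.log n)) atTop (𝓝 1) := by
  have h := (Real.tendsto_mul_log_one_add_div_atTop 1).comp tendsto_natCast_atTop_atTop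
  refine h.congr' ?_
  filter_upwards [eventually_ge_atTop 1] with n hn
  have hn' : (0 : ℝ) < n := by exact_mod_cast hn
  rw [Function.comp_apply, ← Real.log_div (by positivity) hn'.ne']
  congr 2
  field_simp

theorem tendsto_logIncrement {b : ℕ} (hb : b = 1 ∨ b = 2) :
    Tendsto (fun n : ℕ => logIncrement b n / (n + 1) - b * Real.log (n + 1)) atTop
      (𝓝 (b * Real.log (b / 2) - b)) := by
  have h1 := (tendsto_add_atTop_iff_nat 1).2 tendsto_log_factorial
  have h2 := (tendsto_add_atTop_iff_nat 1).2 tendsto_log_div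
  have h3 : Tendsto (fun n : ℕ => Real.log 2 / ((n : ℝ) + 1)) atTop (𝓝 0) := by
    have := tendsto_one_div_add_atTop_nhds_zero_nat (𝕜 := ℝ) |>.const_mul (Real.log 2)
    simpa [div_eq_mul_inv] using this
  rcases hb with rfl | rfl
  · have h := h1.sub_const (Real.log 2)
    have e : ((1 : ℕ) : ℝ) * Real.log ((1 : ℕ) / 2) - (1 : ℕ) = -1 - Real.log 2 := by
      rw [Nat.cast_one, Real.log_div one_ne_zero two_ne_zero, Real.log_one]
      ring
    rw [e]
    refine h.congr fun n => ?_
    have hn : (n : ℝ) + 1 ≠ 0 := by positivity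
    simp only [logIncrement, if_true]
    push_cast
    field_simp
    ring
  · have h := ((h1.const_mul 2).sub h2).sub h3
    have e : ((2 : ℕ) : ℝ) * Real.log ((2 : ℕ) / 2) - (2 : ℕ) = 2 * -1 - 0 - 0 := by
      norm_num
    rw [e]
    refine h.congr fun n => ?_
    have hn : (n : ℝ) + 1 ≠ 0 := by positivity
    rw [logIncrement, if_neg (by norm_num), Nat.factorial_succ]
    push_cast
    rw [Real.log_mul hn (by positivity)]
    field_simp
    ring

theorem tendsto_uniformMoment_one {b : ℕ} (hb : b = 1 ∨ b = 2) {a : ℝ} (ha : 0 < a) :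
    Tendsto (fun n : ℕ => (Real.log (uniformMoment b (n * a) 1 n)
      - Real.log (uniformMoment b ((n + 1) * a) 1 (n + 1))) / (n + 1)) atTop
      (𝓝 (b * Real.log a - b * Real.log (b / 2) + 3 / 2 * b)) := by
  have hA := tendsto_mul_log_succ_sub
  have hB := (tendsto_add_atTop_iff_nat 1).2 tendsto_log_div
  have hK := tendsto_logIncrement hb
  have hI := tendsto_one_div_add_atTop_nhds_zero_nat (𝕜 := ℝ)
  -- The change of Gaussian scale from `n a` to `(n + 1) a` contributes `b / 2`, and Stirling
  -- contributes `b - b log (b / 2)`; the `b log (n + 1)` terms cancel. Together they make the `3 /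
  -- 2 * b`.
  have h := (((hA.mul ((hI.mul_const (1 - (b : ℝ))).add_const (b / 2 : ℝ))).sub
    (hB.const_mul (b - 1 : ℝ))).add ((((hI.mul_const (1 - (b : ℝ))).add_const (b : ℝ)).mul_const
    (Real.log a)))).sub hK
  refine (h.congr' ?_).trans (le_of_eq ?_)
  · filter_upwards [eventually_ge_atTop 1] with n hn
    have hn' : (0 : ℝ) < n := by exact_mod_cast hn
    have hn1 : (0 : ℝ) < (n : ℝ) + 1 := by positivity
    rw [log_uniformMoment_one hb (mul_pos hn' ha),
      log_uniformMoment_one_succ hb (mul_pos hn1 ha), log_uniformMoment_one hb (mul_pos hn1 ha),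
      Real.log_mul hn'.ne' ha.ne', Real.log_mul hn1.ne' ha.ne']
    push_cast
    field_simp
    ring
  · congr 1
    ring

theorem Admissible.tendsto_uniformMoment {b α : ℕ} (h : Admissible b α) {a : ℝ} (ha : 0 < a) :
    Tendsto (fun n : ℕ => (Real.log (uniformMoment b (n * a) α n)
      - Real.log (uniformMoment b ((n + 1) * a) α (n + 1))) / (n + 1)) atTop
      (𝓝 (b * Real.log a - b * Real.log (b / 2) + 3 / 2 * b)) := by
  have hb : b = 1 ∨ b = 2 := by
    rcases h with h | h
    exacts [Or.inl h.1, Or.inr h.1]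
  have h1 := tendsto_uniformMoment_one hb ha
  have hI := tendsto_one_div_add_atTop_nhds_zero_nat (𝕜 := ℝ)
  have hB := (tendsto_add_atTop_iff_nat 1).2 tendsto_log_div
  have hsmall : Tendsto (fun n : ℕ => 2 * (Real.log 2 * (1 / ((n : ℝ) + 1))
      + Real.log ((n + 1 : ℕ) : ℝ) / ((n + 1 : ℕ) : ℝ))) atTop (𝓝 0) := by
    simpa using ((hI.const_mul (Real.log 2)).add hB).const_mul 2
  -- The increment of `log n! - n log (n a)` from `n + 1` to `n`: the logarithms of `n + 1` from the
  -- factorial cancel, leaving a bounded quantity.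
  have hmain : Tendsto (fun n : ℕ => ((α : ℝ) - 1) / 2 * ((Real.log a
      + n * (Real.log (n + 1) - Real.log n)) * (1 / ((n : ℝ) + 1)))) atTop (𝓝 0) := by
    simpa using ((tendsto_mul_log_succ_sub.const_add (Real.log a)).mul hI).const_mul
      (((α : ℝ) - 1) / 2)
  have hdiff := (squeeze_zero_norm' (f := fun n : ℕ => (Real.log (uniformMoment b (n * a) α n)
      - Real.log (uniformMoment b ((n + 1) * a) α (n + 1))) / (n + 1)
      - (Real.log (uniformMoment b (n * a) 1 n)
      - Real.log (uniformMoment b ((n + 1) * a) 1 (n + 1))) / (n + 1)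
      - ((α : ℝ) - 1) / 2 * ((Real.log a
      + n * (Real.log (n + 1) - Real.log n)) * (1 / ((n : ℝ) + 1)))) ?_ hsmall)
  · have := (hdiff.add hmain).add h1
    simp only [zero_add] at this
    refine this.congr fun n => ?_
    ring
  filter_upwards [eventually_ge_atTop 1] with n hn
  have hn' : (0 : ℝ) < n := by exact_mod_cast hn
  have hn1 : (0 : ℝ) < (n : ℝ) + 1 := by positivity
  have e1 := abs_le.1 (h.abs_log_uniformMoment_sub_le (mul_pos hn' ha) hn)
  have e2 := abs_le.1 (h.abs_log_uniformMoment_sub_le (mul_pos hn1 ha) (Nat.le_add_left 1 n))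
  rw [Real.log_mul hn'.ne' ha.ne'] at e1
  rw [Real.log_mul hn1.ne' ha.ne', Nat.factorial_succ] at e2
  push_cast at e2
  rw [Real.log_mul hn1.ne' (by positivity), Real.log_mul two_ne_zero hn1.ne'] at e2
  rw [Real.log_mul two_ne_zero hn'.ne'] at e1
  have e3 : Real.log n ≤ Real.log (n + 1) := Real.log_le_log hn' (by linarith)
  set u := Real.log (uniformMoment b (n * a) α n)
  set v := Real.log (uniformMoment b ((n + 1) * a) α (n + 1))
  set u' := Real.log (uniformMoment b (n * a) 1 n)
  set v' := Real.log (uniformMoment b ((n + 1) * a) 1 (n + 1))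
  have e4 : (u - v) / (n + 1) - (u' - v') / (n + 1)
      - ((α : ℝ) - 1) / 2 * ((Real.log a
      + n * (Real.log (n + 1) - Real.log n)) * (1 / ((n : ℝ) + 1)))
      = (u - v - (u' - v') - ((α : ℝ) - 1) / 2 * (Real.log a
      + n * (Real.log (n + 1) - Real.log n))) / (n + 1) := by
    field_simp
  have e5 : 2 * (Real.log 2 * (1 / ((n : ℝ) + 1)) + Real.log ((n + 1 : ℕ) : ℝ) / ((n + 1 : ℕ) : ℝ))
      = (2 * (Real.log 2 + Real.log (n + 1))) / (n + 1) := by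
    push_cast
    field_simp
  rw [e4, e5, Real.norm_eq_abs, abs_div, abs_of_pos hn1]
  refine div_le_div_of_nonneg_right ?_ hn1.le
  rw [abs_le]
  constructor <;> linarith

/-! ### Partition functions as moments, and the conclusion -/

theorem restrict_domain (n : ℕ) : (volume : Measure (Fin n → ℝ)).restrict (domain n) = orthant n := by
  have h : domain n = Set.univ.pi fun _ => Set.Ici (0 : ℝ) := by
    ext x
    simp [domain, Pi.le_def]
  rw [h, volume_pi, Measure.restrict_pi_pi]
  simp only [orthant, halfLine, restrict_Ioi_eq_restrict_Ici]

theorem density_ae_eq (𝒞 : SymClass) (σ : ℝ) {b α n : ℕ} (hb : 𝒞.β = b) (hα : 𝒞.α = α)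
    (hn : 1 ≤ n) :
    density 𝒞 σ n =ᵐ[orthant n]
      fun x => (∏ i, x i ^ α) * kernel b (n * (1 / (𝒞.ψ * σ ^ 2))) x := by
  filter_upwards [ae_orthant_pos n] with x hx
  have hn' : (n : ℝ) ≠ 0 := by positivity
  have h1 : ∀ i, weight 𝒞 σ n (x i) ^ n
      = x i ^ α * Real.exp (-(n * (1 / (𝒞.ψ * σ ^ 2))) * x i ^ 2) := by
    intro i
    rw [weight, mul_pow, ← Real.rpow_natCast, ← Real.rpow_mul (hx i).le, div_mul_cancel₀ _ hn', hα,
      Real.rpow_natCast, ← Real.exp_nat_mul]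
    congr 2
    ring
  simp only [density, h1, hb, Real.rpow_natCast, Finset.prod_mul_distrib, Finset.prod_pow, kernel,
    sqVandermonde, gauss]
  ring

theorem SymClass.exists_admissible (𝒞 : SymClass) :
    ∃ b α : ℕ, 𝒞.β = b ∧ 𝒞.α = α ∧ Admissible b α := by
  cases 𝒞
  · exact ⟨2, 2, by simp [SymClass.β], by simp [SymClass.α], by simp [Admissible]⟩
  · exact ⟨2, 0, by simp [SymClass.β], by simp [SymClass.α], by simp [Admissible]⟩
  · exact ⟨2, 2, by simp [SymClass.β], by simp [SymClass.α], by simp [Admissible]⟩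
  · exact ⟨1, 1, by simp [SymClass.β], by simp [SymClass.α], by simp [Admissible]⟩

theorem SymClass.ψ_pos (𝒞 : SymClass) : 0 < 𝒞.ψ := by
  cases 𝒞 <;> norm_num [SymClass.ψ]

end BdG

theorem mainTheorem6 (𝒞 : BdG.SymClass) (σ : ℝ) (hσ : 0 < σ) :
    (∀ n : ℕ, 1 ≤ n →
      IntegrableOn (BdG.density 𝒞 σ n) (BdG.domain n) ∧ 0 < BdG.Z 𝒞 σ n) ∧
    Tendsto (fun n : ℕ => 1 / (n : ℝ) * Real.log (BdG.Z 𝒞 σ (n - 1) / BdG.Z 𝒞 σ n)) atTop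
      (𝓝 (-𝒞.β * Real.log (𝒞.β * 𝒞.ψ * σ ^ 2 / 2) + 3 / 2 * 𝒞.β)) := by
  obtain ⟨b, α, hb, hα, hadm⟩ := 𝒞.exists_admissible
  have hψ := 𝒞.ψ_pos
  set a := 1 / (𝒞.ψ * σ ^ 2) with ha'
  have ha : 0 < a := by positivity
  have hZ : ∀ n : ℕ, 1 ≤ n → BdG.Z 𝒞 σ n = BdG.uniformMoment b (n * a) α n := by
    intro n hn
    rw [BdG.Z, BdG.restrict_domain, integral_congr_ae (BdG.density_ae_eq 𝒞 σ hb hα hn)]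
    rfl
  have hpos : ∀ n : ℕ, 1 ≤ n → 0 < BdG.Z 𝒞 σ n := by
    intro n hn
    rw [hZ n hn]
    have : (0 : ℝ) < n := by exact_mod_cast hn
    exact hadm.uniformMoment_pos (by positivity) n
  refine ⟨fun n hn => ⟨?_, hpos n hn⟩, ?_⟩
  · have : (0 : ℝ) < n := by exact_mod_cast hn
    rw [IntegrableOn, BdG.restrict_domain]
    exact (BdG.integrable_moment b (mul_pos this ha) fun _ => α).congr
      (BdG.density_ae_eq 𝒞 σ hb hα hn).symm
  · rw [← tendsto_add_atTop_iff_nat 1]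
    refine ((hadm.tendsto_uniformMoment ha).congr' ?_).trans (le_of_eq ?_)
    · filter_upwards [eventually_ge_atTop 1] with n hn
      rw [Nat.add_sub_cancel, Real.log_div (hpos n hn).ne' (hpos (n + 1) (by omega)).ne',
        hZ n hn, hZ (n + 1) (by omega)]
      push_cast
      ring
    · have hb0 : (b : ℝ) ≠ 0 := by
        rcases hadm with h | h <;> simp [h.1]
      rw [hb, ha', one_div, Real.log_inv,
        show (b : ℝ) * 𝒞.ψ * σ ^ 2 / 2 = (b / 2) * (𝒞.ψ * σ ^ 2) by ring,
        Real.log_mul (x := b / 2) (y := 𝒞.ψ * σ ^ 2) (by positivity) (by positivity)]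
      congr 1
      ring
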